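/- Let $\mathcal K^n$ be the family of nonempty compact convex subsets (convex bodies) of $\mathbb R^n$, and let $C\in\mathcal K^n$ have nonempty interior ($C$ need not be centrally symmetric). For $K\in\mathcal K^n$ let $h(K,s)=\max\{s^Tx : x\in K\}$ be the support function of $K$, let $R(K,C)$ be the smallest $\lambda\ge 0$ such that $K\subset c+\lambda C$ for some $c\in\mathbb R^n$, and let $$D(K,C)=2\max\{R([x,y],C) : x,y\in K\},\qquad w(K,C)=\min_{s\ne 0}\frac{2h(K-K,s)}{h(C-C,s)}$$ be the diameter and the minimal width of $K$ with respect to $C$ (for $n=0$, where there is no direction $s\neq 0$, put $w(K,C)=0$). The body $K$ is called complete with respect to $C$ if $D(K',C)>D(K,C)$ for every $K'\in\mathcal K^n$ with $K'\supsetneq K$; reduced with respect to $C$ if $w(K',C)<w(K,C)$ for every $K'\in\mathcal K^n$ with $K'\subsetneq K$; and of constant width with respect to $C$ if $w(K,C)=D(K,C)$. Theorem. Let $S\in\mathcal K^n$ be an $n$-simplex, i.e. the convex hull of $n+1$ affinely independent points of $\mathbb R^n$. If $S$ is both complete and reduced with respect to $C$, then $S$ is of constant width with respect to $C$, i.e.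 $w(S,C)=D(S,C)$; moreover $S-S=\rho(C-C)$ for some $\rho>0$. -/

import Mathlib

open scoped Pointwise

namespace GenMinkowski

/-- The support function `h(K, a) = max {aᵀ x : x ∈ K}` of a (compact, nonempty) set `K`. -/
noncomputable def supportFn {n : ℕ} (K : Set (EuclideanSpace ℝ (Fin n)))
    (a : EuclideanSpace ℝ (Fin n)) : ℝ :=
  sSup ((fun x => inner ℝ a x) '' K)

/-- The circumradius `R(K, C)`: the smallest `r ≥ 0` such that a translate of `r C` contains `K`. -/
noncomputable def circumradius {n : ℕ} (K C : Set (EuclideanSpace ℝ (Fin n))) : ℝ :=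
  sInf {r : ℝ | 0 ≤ r ∧ ∃ c : EuclideanSpace ℝ (Fin n), K ⊆ c +ᵥ r • C}

/-- The diameter `D(K, C) = 2 max {R([x, y], C) : x, y ∈ K}`. -/
noncomputable def diameter {n : ℕ} (K C : Set (EuclideanSpace ℝ (Fin n))) : ℝ :=
  2 * sSup {r : ℝ | ∃ x ∈ K, ∃ y ∈ K, r = circumradius (segment ℝ x y) C}

/-- The `s`-breadth `b_s(K, C) = 2 h(K - K, s) / h(C - C, s)`, for a direction `s ≠ 0`. -/
noncomputable def breadth {n : ℕ} (K C : Set (EuclideanSpace ℝ (Fin n)))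
    (s : EuclideanSpace ℝ (Fin n)) : ℝ :=
  2 * supportFn (K - K) s / supportFn (C - C) s

/-- The minimal width `w(K, C) = min {b_s(K, C) : s ≠ 0}`. -/
noncomputable def width {n : ℕ} (K C : Set (EuclideanSpace ℝ (Fin n))) : ℝ :=
  sInf {b : ℝ | ∃ s : EuclideanSpace ℝ (Fin n), s ≠ 0 ∧ b = breadth K C s}

/-- `K` is complete with respect to `C`: every convex body properly containing `K` has
larger diameter. -/
def IsComplete {n : ℕ} (K C : ConvexBody (EuclideanSpace ℝ (Fin n))) : Prop :=
  ∀ K' : ConvexBody (EuclideanSpace ℝ (Fin n)),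
    (K : Set (EuclideanSpace ℝ (Fin n))) ⊂ (K' : Set (EuclideanSpace ℝ (Fin n))) →
      diameter (K : Set (EuclideanSpace ℝ (Fin n))) (C : Set (EuclideanSpace ℝ (Fin n))) <
        diameter (K' : Set (EuclideanSpace ℝ (Fin n))) (C : Set (EuclideanSpace ℝ (Fin n)))

/-- `K` is reduced with respect to `C`: every convex body properly contained in `K` has
smaller minimal width. -/
def IsReduced {n : ℕ} (K C : ConvexBody (EuclideanSpace ℝ (Fin n))) : Prop :=
  ∀ K' : ConvexBody (EuclideanSpace ℝ (Fin n)),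
    (K' : Set (EuclideanSpace ℝ (Fin n))) ⊂ (K : Set (EuclideanSpace ℝ (Fin n))) →
      width (K' : Set (EuclideanSpace ℝ (Fin n))) (C : Set (EuclideanSpace ℝ (Fin n))) <
        width (K : Set (EuclideanSpace ℝ (Fin n))) (C : Set (EuclideanSpace ℝ (Fin n)))

/-- `K` is of constant width with respect to `C`: `w(K, C) = D(K, C)`. -/
def IsConstantWidth {n : ℕ} (K C : ConvexBody (EuclideanSpace ℝ (Fin n))) : Prop :=
  width (K : Set (EuclideanSpace ℝ (Fin n))) (C : Set (EuclideanSpace ℝ (Fin n))) =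
    diameter (K : Set (EuclideanSpace ℝ (Fin n))) (C : Set (EuclideanSpace ℝ (Fin n)))

/-- An `n`-simplex in `ℝⁿ`: the convex hull of `n + 1` affinely independent points. -/
def IsNSimplex {n : ℕ} (S : ConvexBody (EuclideanSpace ℝ (Fin n))) : Prop :=
  ∃ p : Fin (n + 1) → EuclideanSpace ℝ (Fin n),
    AffineIndependent ℝ p ∧
      (S : Set (EuclideanSpace ℝ (Fin n))) = convexHull ℝ (Set.range p)

end GenMinkowski

/-!
Write `A = C - C` for the difference body of the gauge body, and measure lengths with the gauge
of `A`, which is a norm. Twice the gauge of `x - y` is the diameter of the segment `[x, y]`, so the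
half-diameter `d` is the least number with `S - S ⊆ d • A` (`sub_subset_half_diameter_smul`); by
separation, the half-width `w` is the largest number with `w • A ⊆ S - S`
(`half_width_smul_subset`, `le_width_of_smul_subset`). Thus `w • A ⊆ S - S ⊆ d • A`, and
everything follows once `d ≤ w` is known.

For a simplex `S`, let `u i` be the linear part of the `i`-th barycentric coordinate.

* Completeness forces `d • A` into the strip `|u i| ≤ 1` (`linear_coord_le_one_of_complete`):
  if some `z ∈ d • A` had `u i z > 1`, then `p i - z` would lie strictly beyond the facet opposite
  to the vertex `p i`. Starting from a relatively interior point of that facet, whose distance to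
  the other vertices is less than `d`, a short step towards `p i - z` leaves `S` while all distances
  to vertices stay at most `d`. Adjoining the resulting point to `S` does not increase the diameter.
* Reducedness forces `w • A` to come arbitrarily close to the boundary of the same strip
  (`exists_lt_abs_linear_coord_of_reduced`): cutting the vertex `p i` off `S` by the
  hyperplane on which the `i`-th coordinate is `r < 1` removes from `S - S` only points with
  `|u i| > r`, because the common part of the `i`-th coordinates of two points of `S` can
  be moved to another vertex without changing their difference. As the truncated simplex has smaller
  width, some point of `w • A` has been removed.

If `w < d`, then `|u i| ≤ w / d` on `w • A` by completeness, while reducedness with `r = w / d`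
yields a point of `w • A` with `|u i| > w / d`. Hence `d ≤ w`.
In dimension `0` there are no directions, and width, diameter and difference bodies all vanish.
-/

open Set Filter Topology

namespace GenMinkowski

/-! ### The difference body and its gauge -/

theorem sub_self_mem_nhds_zero {E : Type*} [NormedAddCommGroup E] {C : Set E}
    (hC : (interior C).Nonempty) : C - C ∈ 𝓝 (0 : E) := by
  obtain ⟨c, hc⟩ := hC
  refine mem_of_superset ((isOpen_interior.sub_right (t := interior C)).mem_nhds ?_)
    (sub_subset_sub interior_subset interior_subset)
  exact ⟨c, hc, c, hc, sub_self c⟩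

theorem isCompact_sub_self {E : Type*} [NormedAddCommGroup E] {C : Set E}
    (hC : IsCompact C) : IsCompact (C - C) := by
  rw [sub_eq_add_neg]
  exact hC.add hC.neg

section Gauge

variable {E : Type*} [NormedAddCommGroup E] [NormedSpace ℝ E]

theorem mem_smul_iff_gauge_le {A : Set E} (hA : Convex ℝ A) (hA' : IsCompact A)
    (hA0 : A ∈ 𝓝 (0 : E)) {r : ℝ} (hr : 0 ≤ r) {v : E} : v ∈ r • A ↔ gauge A v ≤ r := by
  refine ⟨gauge_le_of_mem hr, fun h => ?_⟩
  rcases hr.eq_or_lt with rfl | hr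
  · have hv : gauge A v = 0 := le_antisymm h (gauge_nonneg v)
    rw [gauge_eq_zero (absorbent_nhds_zero hA0)
      ((NormedSpace.isVonNBounded_iff ℝ).2 hA'.isBounded)] at hv
    rw [hv]
    exact ⟨0, mem_of_mem_nhds hA0, by simp⟩
  · rw [mem_smul_set_iff_inv_smul_mem₀ hr.ne', ← hA'.isClosed.closure_eq,
      ← gauge_le_one_iff_mem_closure hA hA0, gauge_smul_of_nonneg (inv_nonneg.2 hr.le), smul_eq_mul,
      inv_mul_le_iff₀ hr, mul_one]
    exact h

theorem gauge_sub_self_neg (C : Set E) (v : E) : gauge (C - C) (-v) = gauge (C - C) v :=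
  gauge_neg (fun x hx => by rwa [← neg_sub C C, Set.mem_neg, neg_neg]) v

theorem gauge_sub_le_of_mem_convexHull {A X : Set E} (hA : Convex ℝ A) (hA0 : A ∈ 𝓝 (0 : E))
    {r : ℝ} (h : ∀ x ∈ X, ∀ y ∈ X, gauge A (x - y) ≤ r) {x y : E} (hx : x ∈ convexHull ℝ X)
    (hy : y ∈ convexHull ℝ X) : gauge A (x - y) ≤ r := by
  have hsub : convexHull ℝ (X - X) ⊆ {v | gauge A v ≤ r} := by
    refine convexHull_min ?_ (hA.setOfPred_gauge_le (mem_of_mem_nhds hA0) (absorbent_nhds_zero hA0) r)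
    rintro _ ⟨a, ha, b, hb, rfl⟩
    exact h a ha b hb
  apply hsub
  rw [convexHull_sub]
  exact sub_mem_sub hx hy

end Gauge

/-! ### Diameter -/

variable {n : ℕ}

theorem circumradius_segment {C : Set (EuclideanSpace ℝ (Fin n))} (hC : Convex ℝ C)
    (hC' : IsCompact C) (hC0 : (interior C).Nonempty) (x y : EuclideanSpace ℝ (Fin n)) :
    circumradius (segment ℝ x y) C = gauge (C - C) (x - y) := by
  have hset : {r : ℝ | 0 ≤ r ∧ ∃ c : EuclideanSpace ℝ (Fin n), segment ℝ x y ⊆ c +ᵥ r • C}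
      = Ici (gauge (C - C) (x - y)) := by
    ext r
    constructor
    · rintro ⟨hr, c, hc⟩
      obtain ⟨_, ⟨a, ha, rfl⟩, hx⟩ := hc (left_mem_segment ℝ x y)
      obtain ⟨_, ⟨b, hb, rfl⟩, hy⟩ := hc (right_mem_segment ℝ x y)
      refine gauge_le_of_mem hr ⟨a - b, sub_mem_sub ha hb, ?_⟩
      simp only [vadd_eq_add] at hx hy ⊢
      rw [← hx, ← hy, smul_sub]
      abel
    · intro h
      have hr : 0 ≤ r := (gauge_nonneg _).trans h
      obtain ⟨_, ⟨a, ha, b, hb, rfl⟩, hab⟩ := (mem_smul_iff_gauge_le (hC.sub hC)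
        (isCompact_sub_self hC') (sub_self_mem_nhds_zero hC0) hr).2 h
      refine ⟨hr, x - r • a, ((hC.smul r).vadd _).segment_subset ?_ ?_⟩
      · exact ⟨r • a, smul_mem_smul_set ha, by simp⟩
      · refine ⟨r • b, smul_mem_smul_set hb, ?_⟩
        simp only [vadd_eq_add, smul_sub] at hab ⊢
        rw [← sub_sub_cancel x y, ← hab]
        abel
  rw [circumradius, hset, csInf_Ici]

theorem gauge_sub_le_half_diameter {K C : Set (EuclideanSpace ℝ (Fin n))} (hK : IsCompact K)
    (hC : Convex ℝ C) (hC' : IsCompact C) (hC0 : (interior C).Nonempty)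
    {x y : EuclideanSpace ℝ (Fin n)} (hx : x ∈ K) (hy : y ∈ K) :
    gauge (C - C) (x - y) ≤ diameter K C / 2 := by
  have hb : BddAbove {r : ℝ | ∃ x ∈ K, ∃ y ∈ K, r = circumradius (segment ℝ x y) C} := by
    refine ((isCompact_sub_self hK).bddAbove_image (f := gauge (C - C))
      (continuous_gauge (hC.sub hC) (sub_self_mem_nhds_zero hC0)).continuousOn).mono ?_
    rintro _ ⟨x, hx, y, hy, rfl⟩
    exact ⟨x - y, sub_mem_sub hx hy, (circumradius_segment hC hC' hC0 x y).symm⟩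
  have := le_csSup hb ⟨x, hx, y, hy, (circumradius_segment hC hC' hC0 x y).symm⟩
  rw [diameter]
  linarith

theorem diameter_le {K C : Set (EuclideanSpace ℝ (Fin n))} (hK : K.Nonempty)
    (hC : Convex ℝ C) (hC' : IsCompact C) (hC0 : (interior C).Nonempty) {r : ℝ}
    (h : ∀ x ∈ K, ∀ y ∈ K, gauge (C - C) (x - y) ≤ r) : diameter K C ≤ 2 * r := by
  obtain ⟨z, hz⟩ := hK
  refine mul_le_mul_of_nonneg_left (csSup_le ⟨_, z, hz, z, hz, rfl⟩ ?_) zero_le_two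
  rintro _ ⟨x, hx, y, hy, rfl⟩
  rw [circumradius_segment hC hC' hC0]
  exact h x hx y hy

theorem sub_subset_half_diameter_smul {K C : Set (EuclideanSpace ℝ (Fin n))} (hK : IsCompact K)
    (hC : Convex ℝ C) (hC' : IsCompact C) (hC0 : (interior C).Nonempty) :
    K - K ⊆ (diameter K C / 2) • (C - C) := by
  rintro _ ⟨x, hx, y, hy, rfl⟩
  have h := gauge_sub_le_half_diameter hK hC hC' hC0 hx hy
  exact (mem_smul_iff_gauge_le (hC.sub hC) (isCompact_sub_self hC') (sub_self_mem_nhds_zero hC0)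
    ((gauge_nonneg _).trans h)).2 h

/-! ### Width -/

theorem inner_le_supportFn {K : Set (EuclideanSpace ℝ (Fin n))} (hK : IsCompact K)
    (s : EuclideanSpace ℝ (Fin n)) {x : EuclideanSpace ℝ (Fin n)} (hx : x ∈ K) :
    inner ℝ s x ≤ supportFn K s :=
  le_csSup (hK.bddAbove_image (by fun_prop)) ⟨x, hx, rfl⟩

theorem supportFn_le {K : Set (EuclideanSpace ℝ (Fin n))} (hK : K.Nonempty)
    {s : EuclideanSpace ℝ (Fin n)} {r : ℝ} (h : ∀ x ∈ K, inner ℝ s x ≤ r) : supportFn K s ≤ r :=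
  csSup_le (hK.image _) (by rintro _ ⟨x, hx, rfl⟩; exact h x hx)

theorem supportFn_pos {A : Set (EuclideanSpace ℝ (Fin n))} (hA : IsCompact A)
    (hA0 : A ∈ 𝓝 (0 : EuclideanSpace ℝ (Fin n))) {s : EuclideanSpace ℝ (Fin n)} (hs : s ≠ 0) :
    0 < supportFn A s := by
  have hlim : Tendsto (fun t : ℝ => t • s) (𝓝[>] 0) (𝓝 0) := by
    have h : Continuous fun t : ℝ => t • s := by fun_prop
    simpa using (h.tendsto 0).mono_left nhdsWithin_le_nhds
  obtain ⟨t, htA, ht⟩ := ((hlim.eventually hA0).and self_mem_nhdsWithin).exists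
  refine lt_of_lt_of_le ?_ (inner_le_supportFn hA s htA)
  rw [inner_smul_right]
  exact mul_pos ht (real_inner_self_pos.2 hs)

theorem supportFn_sub_self_nonneg {K : Set (EuclideanSpace ℝ (Fin n))} (hK : IsCompact K)
    (hK' : K.Nonempty) (s : EuclideanSpace ℝ (Fin n)) : 0 ≤ supportFn (K - K) s := by
  obtain ⟨x, hx⟩ := hK'
  simpa using inner_le_supportFn (isCompact_sub_self hK) s (sub_mem_sub hx hx)

theorem width_le_breadth {K C : Set (EuclideanSpace ℝ (Fin n))} (hK : IsCompact K)
    (hK' : K.Nonempty) (hC : IsCompact C) (hC' : C.Nonempty) {s : EuclideanSpace ℝ (Fin n)}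
    (hs : s ≠ 0) : width K C ≤ breadth K C s := by
  refine csInf_le ⟨0, ?_⟩ ⟨s, hs, rfl⟩
  rintro _ ⟨s, -, rfl⟩
  exact div_nonneg (mul_nonneg zero_le_two (supportFn_sub_self_nonneg hK hK' s))
    (supportFn_sub_self_nonneg hC hC' s)

theorem half_width_smul_subset {K C : Set (EuclideanSpace ℝ (Fin n))} (hK : Convex ℝ K)
    (hK' : IsCompact K) (hKne : K.Nonempty) (hC' : IsCompact C)
    (hC0 : (interior C).Nonempty) : (width K C / 2) • (C - C) ⊆ K - K := by
  rintro _ ⟨v, hv, rfl⟩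
  by_contra hout
  obtain ⟨f, u, hfu, hu⟩ := geometric_hahn_banach_closed_point (hK.sub hK)
    (isCompact_sub_self hK').isClosed hout
  obtain ⟨s, rfl⟩ := (InnerProductSpace.toDual ℝ _).surjective f
  simp only [InnerProductSpace.toDual_apply_apply] at hfu hu
  have hhK : supportFn (K - K) s ≤ u := supportFn_le (hKne.sub hKne) fun x hx => (hfu x hx).le
  have hs : s ≠ 0 := by
    rintro rfl
    obtain ⟨x, hx⟩ := hKne
    have := hfu _ (sub_mem_sub hx hx)
    simp only [inner_zero_left] at this hu
    linarith
  have hpos := supportFn_pos (isCompact_sub_self hC') (sub_self_mem_nhds_zero hC0) hs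
  have hb := width_le_breadth hK' hKne hC' (hC0.mono interior_subset) hs
  rw [breadth, le_div_iff₀ hpos] at hb
  have hw : 0 ≤ width K C := by
    refine Real.sInf_nonneg ?_
    rintro _ ⟨s, -, rfl⟩
    exact div_nonneg (mul_nonneg zero_le_two (supportFn_sub_self_nonneg hK' hKne s))
      (supportFn_sub_self_nonneg hC' (hC0.mono interior_subset) s)
  have hv' := mul_le_mul_of_nonneg_left (inner_le_supportFn (isCompact_sub_self hC') s hv)
    (div_nonneg hw zero_le_two)
  rw [inner_smul_right] at hu
  linarith

theorem le_width_of_smul_subset [Nontrivial (EuclideanSpace ℝ (Fin n))]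
    {K C : Set (EuclideanSpace ℝ (Fin n))}
    (hK' : IsCompact K) (hC' : IsCompact C) (hC0 : (interior C).Nonempty)
    {r : ℝ} (hr : 0 ≤ r) (h : r • (C - C) ⊆ K - K) : 2 * r ≤ width K C := by
  obtain ⟨s₀, hs₀⟩ := exists_ne (0 : EuclideanSpace ℝ (Fin n))
  refine le_csInf ⟨_, s₀, hs₀, rfl⟩ ?_
  rintro _ ⟨s, hs, rfl⟩
  have hpos := supportFn_pos (isCompact_sub_self hC') (sub_self_mem_nhds_zero hC0) hs
  have hne : (C - C).Nonempty := ⟨0, mem_of_mem_nhds (sub_self_mem_nhds_zero hC0)⟩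
  rw [breadth, le_div_iff₀ hpos, mul_assoc]
  refine mul_le_mul_of_nonneg_left ?_ zero_le_two
  rcases hr.eq_or_lt with rfl | hr
  · obtain ⟨v, hv⟩ := hne
    simpa using inner_le_supportFn (isCompact_sub_self hK') s (h (smul_mem_smul_set hv))
  · rw [← le_div_iff₀' hr]
    refine supportFn_le hne fun v hv => ?_
    rw [le_div_iff₀' hr, ← inner_smul_right]
    exact inner_le_supportFn (isCompact_sub_self hK') s (h (smul_mem_smul_set hv))

theorem width_le_of_subset_smul [Nontrivial (EuclideanSpace ℝ (Fin n))]
    {K C : Set (EuclideanSpace ℝ (Fin n))} (hK' : IsCompact K) (hKne : K.Nonempty)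
    (hC' : IsCompact C) (hC0 : (interior C).Nonempty)
    {r : ℝ} (hr : 0 ≤ r) (h : K - K ⊆ r • (C - C)) : width K C ≤ 2 * r := by
  obtain ⟨s, hs⟩ := exists_ne (0 : EuclideanSpace ℝ (Fin n))
  have hpos := supportFn_pos (isCompact_sub_self hC') (sub_self_mem_nhds_zero hC0) hs
  refine (width_le_breadth hK' hKne hC' (hC0.mono interior_subset) hs).trans ?_
  rw [breadth, div_le_iff₀ hpos, mul_assoc]
  refine mul_le_mul_of_nonneg_left (supportFn_le (hKne.sub hKne) fun x hx => ?_) zero_le_two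
  obtain ⟨v, hv, rfl⟩ := h hx
  rw [inner_smul_right]
  exact mul_le_mul_of_nonneg_left (inner_le_supportFn (isCompact_sub_self hC') s hv) hr

/-! ### Barycentric coordinates of a simplex -/

section Coord

variable {ι E : Type*} [NormedAddCommGroup E] [NormedSpace ℝ E]

theorem coord_add_eq (b : AffineBasis ι ℝ E) (k : ι) (x v : E) :
    b.coord k (x + v) = b.coord k x + (b.coord k).linear v := by
  rw [add_comm x v, ← vadd_eq_add, AffineMap.map_vadd, vadd_eq_add, add_comm]

theorem linear_coord_sub (b : AffineBasis ι ℝ E) (k : ι) (x y : E) :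
    (b.coord k).linear (x - y) = b.coord k x - b.coord k y :=
  (b.coord k).linearMap_vsub x y

theorem mem_convexHull_iff_coord_nonneg (b : AffineBasis ι ℝ E) {x : E} :
    x ∈ convexHull ℝ (range b) ↔ ∀ k, 0 ≤ b.coord k x := by
  rw [b.convexHull_eq_nonneg_coord]; rfl

/-- Two points of a simplex may be translated, by the same multiple of the edge `b j - b i`, to
points of the simplex of which one has `i`-th coordinate `0`; the other `i`-th coordinate is then
`|(b.coord i).linear v|`, where `v` is their difference. -/
theorem exists_sub_eq_of_linear_coord_le [DecidableEq ι] (b : AffineBasis ι ℝ E) {i j : ι}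
    (hij : i ≠ j) {r : ℝ} (hr : 0 ≤ r) {v : E}
    (hv : v ∈ convexHull ℝ (range b) - convexHull ℝ (range b))
    (hvr : |(b.coord i).linear v| ≤ r) :
    v ∈ (convexHull ℝ (range b) ∩ {x | b.coord i x ≤ r}) -
      (convexHull ℝ (range b) ∩ {x | b.coord i x ≤ r}) := by
  obtain ⟨x, hx, y, hy, rfl⟩ := hv
  simp only [linear_coord_sub] at hvr
  rw [mem_convexHull_iff_coord_nonneg] at hx hy
  set m := min (b.coord i x) (b.coord i y) with hm
  have hm0 : 0 ≤ m := le_min (hx i) (hy i)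
  have key : ∀ z k, b.coord k (z + m • (b j - b i)) =
      b.coord k z + m * ((if k = j then 1 else 0) - if k = i then 1 else 0) := by
    intro z k
    rw [coord_add_eq, map_smul, linear_coord_sub, b.coord_apply, b.coord_apply, smul_eq_mul]
  have hmem : ∀ z, (∀ k, 0 ≤ b.coord k z) → m ≤ b.coord i z → b.coord i z - m ≤ r →
      z + m • (b j - b i) ∈ convexHull ℝ (range b) ∩ {x | b.coord i x ≤ r} := by
    intro z hz hmz hzr
    refine ⟨(mem_convexHull_iff_coord_nonneg b).2 fun k => ?_, ?_⟩
    · rw [key]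
      have := hz k
      rcases eq_or_ne k i with rfl | hki
      · simp [hij, hmz]
      · rcases eq_or_ne k j with rfl | hkj
        · simp only [if_true, hki, if_false]; linarith
        · simpa [hki, hkj] using this
    · simp only [mem_ofPred_eq, key, if_neg hij, if_true]
      linarith
  rw [abs_le] at hvr
  refine ⟨_, hmem x hx (min_le_left _ _) ?_, _, hmem y hy (min_le_right _ _) ?_, by simp⟩
  · rcases min_choice (b.coord i x) (b.coord i y) with h | h <;> rw [hm, h] <;> linarith
  · rcases min_choice (b.coord i x) (b.coord i y) with h | h <;> rw [hm, h] <;> linarith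

/-- Suppose that every edge of a simplex has length at most `d`, and that some vector `-z` of length
at most `d` leads from the vertex `b i` across the hyperplane of the opposite
facet. Then there is a point outside the simplex whose distance to each vertex is at most `d`. -/
theorem exists_coord_neg_gauge_sub_le [Fintype ι] [Nontrivial ι]
    (b : AffineBasis ι ℝ E) {A : Set E} (hA : Convex ℝ A) (hA0 : A ∈ 𝓝 (0 : E))
    {d : ℝ} (hd : 0 < d) (hb : ∀ k l, gauge A (b k - b l) ≤ d) (i : ι) {z : E}
    (hz : gauge A (-z) ≤ d) (hz1 : 1 < (b.coord i).linear z) :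
    ∃ q, b.coord i q < 0 ∧ ∀ k, gauge A (q - b k) ≤ d := by
  classical
  have habs := absorbent_nhds_zero (𝕜 := ℝ) hA0
  set F := Finset.univ.erase i with hF
  have hFne : F.Nonempty := by
    obtain ⟨j, hj⟩ := exists_ne i
    exact ⟨j, by simp [hF, hj]⟩
  set N : ℝ := (F.card : ℝ) with hN
  have hNpos : 0 < N := Nat.cast_pos.2 hFne.card_pos
  -- The barycentre of the facet opposite to `b i`.
  set x : E := ∑ k ∈ F, N⁻¹ • b k with hxdef
  have hsub : ∀ y, x - y = ∑ k ∈ F, N⁻¹ • (b k - y) := by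
    intro y
    simp only [smul_sub, Finset.sum_sub_distrib, Finset.sum_const, hxdef]
    rw [← Nat.cast_smul_eq_nsmul ℝ, smul_smul, ← hN, mul_inv_cancel₀ hNpos.ne', one_smul]
  have hgauge : ∀ y, gauge A (x - y) ≤ ∑ k ∈ F, N⁻¹ * gauge A (b k - y) := by
    intro y
    rw [hsub]
    refine (gauge_sum_le hA habs _ _).trans_eq (Finset.sum_congr rfl fun k _ => ?_)
    rw [gauge_smul_of_nonneg (inv_nonneg.2 hNpos.le), smul_eq_mul]
  have hsum : ∑ k ∈ F, N⁻¹ * d = d := by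
    rw [Finset.sum_const, nsmul_eq_mul, ← hN, mul_inv_cancel_left₀ hNpos.ne']
  have hxi : gauge A (x - b i) ≤ d := by
    refine (hgauge _).trans (le_trans (Finset.sum_le_sum fun k _ => ?_) hsum.le)
    exact mul_le_mul_of_nonneg_left (hb k i) (inv_nonneg.2 hNpos.le)
  -- For `l ≠ i`, the summand with `k = l` vanishes, which makes the distance strictly less than `d`.
  have hxl : ∀ l, l ≠ i → gauge A (x - b l) < d := by
    intro l hl
    refine (hgauge _).trans_lt (lt_of_lt_of_eq (Finset.sum_lt_sum (fun k _ => ?_)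
      ⟨l, by simp [hF, hl], ?_⟩) hsum)
    · exact mul_le_mul_of_nonneg_left (hb k l) (inv_nonneg.2 hNpos.le)
    · simpa using mul_pos (inv_pos.2 hNpos) hd
  have hlin : (b.coord i).linear (x - b i) = -1 := by
    rw [hsub, map_sum]
    have : ∀ k ∈ F, (b.coord i).linear (N⁻¹ • (b k - b i)) = -N⁻¹ := by
      intro k hk
      have hki : i ≠ k := (Finset.ne_of_mem_erase hk).symm
      rw [map_smul, linear_coord_sub, b.coord_apply, b.coord_apply]
      simp [hki]
    rw [Finset.sum_congr rfl this, Finset.sum_const, nsmul_eq_mul, ← hN, mul_neg,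
      mul_inv_cancel₀ hNpos.ne']
  have hcont : ∀ l, l ≠ i → ∀ᶠ δ : ℝ in 𝓝[>] 0, gauge A (x + δ • (b i - z - x) - b l) < d := by
    intro l hl
    have hc : Continuous fun δ : ℝ => gauge A (x + δ • (b i - z - x) - b l) :=
      (continuous_gauge hA hA0).comp (by fun_prop)
    refine ((hc.tendsto 0).mono_left nhdsWithin_le_nhds).eventually_lt_const ?_
    simpa using hxl l hl
  have hall : ∀ᶠ δ : ℝ in 𝓝[>] 0, ∀ l, l ≠ i → gauge A (x + δ • (b i - z - x) - b l) < d := by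
    rw [eventually_all]
    intro l
    by_cases hl : l = i
    · simp [hl]
    · filter_upwards [hcont l hl] with δ hδ _ using hδ
  obtain ⟨δ, hδ, hδ0, hδ1⟩ := (hall.and (Ioo_mem_nhdsGT zero_lt_one)).exists
  refine ⟨x + δ • (b i - z - x), ?_, fun k => ?_⟩
  · have hx : x + δ • (b i - z - x) = b i + ((1 - δ) • (x - b i) + δ • (-z)) := by module
    rw [hx, coord_add_eq, map_add, map_smul, map_smul, hlin, map_neg, b.coord_apply_eq]
    simp only [smul_eq_mul]
    nlinarith
  · rcases eq_or_ne k i with rfl | hk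
    · have hx : x + δ • (b k - z - x) - b k = (1 - δ) • (x - b k) + δ • (-z) := by module
      rw [hx]
      refine (gauge_add_le hA habs _ _).trans ?_
      rw [gauge_smul_of_nonneg (sub_nonneg.2 hδ1.le), gauge_smul_of_nonneg hδ0.le]
      simp only [smul_eq_mul]
      nlinarith
    · exact (hδ k hk).le

end Coord

/-! ### Complete simplices and reduced simplices -/

theorem linear_coord_le_one_of_complete [NeZero n]
    (S C : ConvexBody (EuclideanSpace ℝ (Fin n)))
    (hC : (interior (C : Set (EuclideanSpace ℝ (Fin n)))).Nonempty)
    (b : AffineBasis (Fin (n + 1)) ℝ (EuclideanSpace ℝ (Fin n)))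
    (hS : (S : Set (EuclideanSpace ℝ (Fin n))) = convexHull ℝ (range b))
    (hcomplete : IsComplete S C) {d : ℝ}
    (hdS : diameter (S : Set (EuclideanSpace ℝ (Fin n)))
      (C : Set (EuclideanSpace ℝ (Fin n))) = 2 * d)
    (hd : 0 < d) (i : Fin (n + 1))
    {z : EuclideanSpace ℝ (Fin n)} (hz : gauge (C - C : Set (EuclideanSpace ℝ (Fin n))) z ≤ d) :
    (b.coord i).linear z ≤ 1 := by
  by_contra! hz1
  have hA := C.convex.sub C.convex
  have hA0 := sub_self_mem_nhds_zero hC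
  have hvert : ∀ k, b k ∈ (S : Set (EuclideanSpace ℝ (Fin n))) := fun k =>
    hS ▸ subset_convexHull ℝ _ (mem_range_self k)
  have hb : ∀ k l, gauge (C - C : Set (EuclideanSpace ℝ (Fin n))) (b k - b l) ≤ d := by
    intro k l
    have := gauge_sub_le_half_diameter S.isCompact C.convex C.isCompact hC (hvert k) (hvert l)
    linarith
  obtain ⟨q, hq, hqb⟩ := exists_coord_neg_gauge_sub_le b hA hA0 hd hb i
    (by rwa [gauge_sub_self_neg]) hz1
  have hX : ∀ x ∈ insert q (range b), ∀ y ∈ insert q (range b),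
      gauge (C - C : Set (EuclideanSpace ℝ (Fin n))) (x - y) ≤ d := by
    rintro x (rfl | ⟨k, rfl⟩) y (rfl | ⟨l, rfl⟩)
    · simpa using hd.le
    · exact hqb l
    · rw [← gauge_sub_self_neg, neg_sub]; exact hqb k
    · exact hb k l
  let K' : ConvexBody (EuclideanSpace ℝ (Fin n)) :=
    { carrier := convexHull ℝ (insert q (range b))
      convex' := convex_convexHull ℝ _
      isCompact' := ((finite_range b).insert q).isCompact_convexHull ℝ
      nonempty' := (insert_nonempty _ _).convexHull }
  have hK' : (K' : Set (EuclideanSpace ℝ (Fin n))) = convexHull ℝ (insert q (range b)) := rfl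
  have hlt := hcomplete K' <| by
    rw [ssubset_iff_subset_not_subset, hK']
    refine ⟨hS ▸ convexHull_mono (subset_insert _ _), fun hsub => ?_⟩
    have := hsub (subset_convexHull ℝ _ (mem_insert _ _))
    rw [hS, mem_convexHull_iff_coord_nonneg] at this
    exact absurd (this i) hq.not_ge
  refine absurd hlt (not_lt.2 ?_)
  rw [hdS]
  exact diameter_le K'.nonempty C.convex C.isCompact hC fun x hx y hy =>
    gauge_sub_le_of_mem_convexHull hA hA0 hX hx hy

theorem exists_lt_abs_linear_coord_of_reduced [NeZero n]
    (S C : ConvexBody (EuclideanSpace ℝ (Fin n)))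
    (hC : (interior (C : Set (EuclideanSpace ℝ (Fin n)))).Nonempty)
    (b : AffineBasis (Fin (n + 1)) ℝ (EuclideanSpace ℝ (Fin n)))
    (hS : (S : Set (EuclideanSpace ℝ (Fin n))) = convexHull ℝ (range b))
    (hreduced : IsReduced S C) {w : ℝ}
    (hwS : width (S : Set (EuclideanSpace ℝ (Fin n)))
      (C : Set (EuclideanSpace ℝ (Fin n))) = 2 * w)
    (hw : 0 ≤ w) (i : Fin (n + 1)) {r : ℝ} (hr0 : 0 ≤ r) (hr1 : r < 1) :
    ∃ v ∈ w • ((C : Set (EuclideanSpace ℝ (Fin n))) - (C : Set (EuclideanSpace ℝ (Fin n)))),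
      r < |(b.coord i).linear v| := by
  by_contra! h
  obtain ⟨j, hj⟩ := exists_ne i
  let K' : ConvexBody (EuclideanSpace ℝ (Fin n)) :=
    { carrier := convexHull ℝ (range b) ∩ {x | b.coord i x ≤ r}
      convex' := (convex_convexHull ℝ _).inter ((convex_Iic r).affine_preimage (b.coord i))
      isCompact' := ((finite_range b).isCompact_convexHull ℝ).inter_right
        (isClosed_le (b.coord i).continuous_of_finiteDimensional continuous_const)
      nonempty' := ⟨b j, subset_convexHull ℝ _ (mem_range_self j), by
        simpa [b.coord_apply, hj.symm] using hr0⟩ }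
  have hK' : (K' : Set (EuclideanSpace ℝ (Fin n))) =
    convexHull ℝ (range b) ∩ {x | b.coord i x ≤ r} := rfl
  have hlt := hreduced K' <| by
    rw [ssubset_iff_subset_not_subset, hK', hS]
    refine ⟨inter_subset_left, fun hsub => ?_⟩
    have : b.coord i (b i) ≤ r := (hsub (subset_convexHull ℝ _ (mem_range_self i))).2
    rw [b.coord_apply_eq] at this
    linarith
  refine absurd hlt (not_lt.2 ?_)
  rw [hwS]
  refine le_width_of_smul_subset K'.isCompact C.isCompact hC hw fun v hv => ?_
  refine exists_sub_eq_of_linear_coord_le b hj.symm hr0 ?_ (h v hv)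
  rw [← hS]
  refine half_width_smul_subset S.convex S.isCompact S.nonempty C.isCompact hC ?_
  rwa [hwS, mul_div_cancel_left₀ _ two_ne_zero]

end GenMinkowski

open GenMinkowski in
theorem mainTheorem1 (n : ℕ) (S C : ConvexBody (EuclideanSpace ℝ (Fin n)))
    (hC : (interior (C : Set (EuclideanSpace ℝ (Fin n)))).Nonempty)
    (hS : GenMinkowski.IsNSimplex S)
    (hcomplete : GenMinkowski.IsComplete S C)
    (hreduced : GenMinkowski.IsReduced S C) :
    GenMinkowski.IsConstantWidth S C ∧
      ∃ ρ : ℝ, 0 < ρ ∧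
        (S : Set (EuclideanSpace ℝ (Fin n))) - (S : Set (EuclideanSpace ℝ (Fin n))) =
          ρ • ((C : Set (EuclideanSpace ℝ (Fin n))) - (C : Set (EuclideanSpace ℝ (Fin n)))) := by
  obtain ⟨p, hp, hSp⟩ := hS
  have hCne : (C : Set (EuclideanSpace ℝ (Fin n))).Nonempty := C.nonempty
  have hSne : (S : Set (EuclideanSpace ℝ (Fin n))).Nonempty := S.nonempty
  rcases Nat.eq_zero_or_pos n with rfl | hn
  · -- In dimension `0` there is no direction, so the width is `sInf ∅ = 0`, as is the diameter.
    have hgauge : ∀ v, gauge (C - C : Set (EuclideanSpace ℝ (Fin 0))) v = 0 := fun v => by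
      rw [Subsingleton.elim v 0, gauge_zero]
    refine ⟨?_, 1, one_pos, ?_⟩
    · have hw : width (S : Set (EuclideanSpace ℝ (Fin 0)))
          (C : Set (EuclideanSpace ℝ (Fin 0))) = 0 := by
        have : {b : ℝ | ∃ s : EuclideanSpace ℝ (Fin 0), s ≠ 0 ∧ b = breadth S C s} = ∅ := by
          refine eq_empty_of_forall_notMem ?_
          rintro _ ⟨s, hs, -⟩
          exact hs (Subsingleton.elim _ _)
        rw [width, this, Real.sInf_empty]
      have hd1 := diameter_le hSne C.convex C.isCompact hC (r := 0)
        fun x _ y _ => (hgauge (x - y)).le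
      obtain ⟨x, hx⟩ := hSne
      have hd2 := gauge_sub_le_half_diameter S.isCompact C.convex C.isCompact hC hx hx
      rw [hgauge] at hd2
      rw [IsConstantWidth, hw]
      linarith
    · rw [one_smul, Subsingleton.eq_univ_of_nonempty (hSne.sub hSne),
        Subsingleton.eq_univ_of_nonempty (hCne.sub hCne)]
  · have : NeZero n := ⟨hn.ne'⟩
    let b : AffineBasis (Fin (n + 1)) ℝ (EuclideanSpace ℝ (Fin n)) :=
      ⟨p, hp, hp.affineSpan_eq_top_iff_card_eq_finrank_add_one.2 (by simp)⟩
    have hSb : (S : Set (EuclideanSpace ℝ (Fin n))) = convexHull ℝ (range b) := hSp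
    have hsymm := gauge_sub_self_neg (C : Set (EuclideanSpace ℝ (Fin n)))
    set A := (C : Set (EuclideanSpace ℝ (Fin n))) - (C : Set (EuclideanSpace ℝ (Fin n)))
    have hA0 : A ∈ 𝓝 0 := sub_self_mem_nhds_zero hC
    have hAc : IsCompact A := isCompact_sub_self C.isCompact
    obtain ⟨d, hd⟩ : ∃ d, d = diameter (S : Set (EuclideanSpace ℝ (Fin n)))
      (C : Set (EuclideanSpace ℝ (Fin n))) / 2 := ⟨_, rfl⟩
    obtain ⟨w, hw⟩ : ∃ w, w = width (S : Set (EuclideanSpace ℝ (Fin n)))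
      (C : Set (EuclideanSpace ℝ (Fin n))) / 2 := ⟨_, rfl⟩
    have hSd : (S - S : Set (EuclideanSpace ℝ (Fin n))) ⊆ d • A :=
      hd ▸ sub_subset_half_diameter_smul S.isCompact C.convex C.isCompact hC
    have hwS : w • A ⊆ (S - S : Set (EuclideanSpace ℝ (Fin n))) :=
      hw ▸ half_width_smul_subset S.convex S.isCompact S.nonempty C.isCompact hC
    have hdpos : 0 < d := by
      have h01 : b 0 - b 1 ≠ 0 := by
        rw [sub_ne_zero]
        exact fun h => by simpa using b.ind.injective h
      refine (gauge_pos (absorbent_nhds_zero hA0)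
        ((NormedSpace.isVonNBounded_iff ℝ).2 hAc.isBounded)).2 h01 |>.trans_le ?_
      rw [hd]
      refine gauge_sub_le_half_diameter S.isCompact C.convex C.isCompact hC ?_ ?_ <;>
        exact hSb ▸ subset_convexHull ℝ _ (mem_range_self _)
    have hw0 : 0 ≤ w := by
      have := le_width_of_smul_subset S.isCompact C.isCompact hC le_rfl
        (by
          rw [zero_smul_set (hCne.sub hCne)]
          exact zero_subset.2 (hSne.elim fun x hx => ⟨x, hx, x, hx, sub_self x⟩))
      linarith
    have hwd : w ≤ d := by
      have := width_le_of_subset_smul S.isCompact S.nonempty C.isCompact hC hdpos.le hSd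
      linarith
    -- Completeness bounds the coordinate by `w / d` on `w • A`, so this is the height of the cut.
    have hdw : d ≤ w := by
      by_contra! hlt
      obtain ⟨_, ⟨a, ha, rfl⟩, hav⟩ := exists_lt_abs_linear_coord_of_reduced S C hC b hSb hreduced
        (w := w) (by linarith) hw0 0 (r := w / d) (by positivity) ((div_lt_one hdpos).2 hlt)
      have hg : gauge A (d • a) ≤ d := gauge_le_of_mem hdpos.le (smul_mem_smul_set ha)
      have h1 := linear_coord_le_one_of_complete S C hC b hSb hcomplete (by linarith) hdpos 0 hg
      have h2 := linear_coord_le_one_of_complete S C hC b hSb hcomplete (by linarith) hdpos 0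
        (z := -(d • a)) (by rw [hsymm]; exact hg)
      simp only [map_neg, map_smul, smul_eq_mul] at h1 h2 hav
      have habs : d * |(b.coord 0).linear a| ≤ 1 := by
        have h3 : |d * (b.coord 0).linear a| ≤ 1 := abs_le.2 ⟨by linarith, h1⟩
        rwa [abs_mul, abs_of_pos hdpos] at h3
      rw [abs_mul, abs_of_nonneg hw0, div_lt_iff₀ hdpos] at hav
      nlinarith
    have heq : w = d := le_antisymm hwd hdw
    refine ⟨?_, d, hdpos, hSd.antisymm (heq ▸ hwS)⟩
    rw [IsConstantWidth]
    linarith
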